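/- Let $G$ be a compact (Hausdorff) topological group and $H\subseteq G$ a closed subgroup such that $(G,H)$ is a Gelfand pair, i.e. in every continuous finite-dimensional irreducible complex representation of $G$ the $H$-invariant vectors form a subspace of dimension at most $1$. Let $X=G/H$. A *probabilistic structure* of $(G,H)$ is a nonempty set $\mathcal F$ of continuous functions $\mathbf f:X\to[0,1]$ (outcome probability functions) which is convex, is closed under $\mathbf f\mapsto \mathbf f\circ g$ for $g\in G$ and under $\mathbf f\mapsto \mathbf u-\mathbf f$ (where $\mathbf u\equiv 1$), contains $\mathbf f_i+\mathbf f_j$ whenever $i\neq j$ and $\mathbf f_1,\dots,\mathbf f_n\in\mathcal F$ satisfy $\sum_k\mathbf f_k=\mathbf u$, and whose real linear span $\mathbb R[\mathcal F]$ is finite-dimensional. Its associated representation is the representation of $G$ on $V=\mathbb R[\mathcal F]^*$ given by $(\Gamma_g\omega)(\mathbf f)=\omega(\mathbf f\circ g)$, and the pure states are $\Omega_x\in V$, $\Omega_x(\mathbf f)=\mathbf f(x)$, for $x\in X$. The structure $\mathcal F$ is *unrestricted* if for every linear functional $\Lambda:V\to\mathbb R$ with $\Lambda(\Omega_x)\in[0,1]$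 for all $x\in X$, the function $x\mapsto\Lambda(\Omega_x)$ belongs to $\mathcal F$. For two probabilistic structures put $$D(\mathcal F^0,\mathcal F^1)=\sup_{\mathbf f^0\in\mathcal F^0}\ \inf_{\mathbf f^1\in\mathcal F^1}\ \sup_{x\in X}|\mathbf f^0(x)-\mathbf f^1(x)| .$$ **Theorem.** Let $\mathcal F^0$ and $\mathcal F^1$ be two unrestricted probabilistic structures of $(G,H)$. If some real irreducible representation of $G$, of real dimension $d^0$, is equivalent to a subrepresentation of the representation associated to $\mathcal F^0$ but to no subrepresentation of the representation associated to $\mathcal F^1$, then $$D(\mathcal F^0,\mathcal F^1)\ \ge\ \frac1{4d^0}.$$ -/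

import Mathlib

/-- A complex representation of a topological group is continuous when all its matrix coefficients
are. For a finite-dimensional `V` this is continuity of `G → GL(V)`. -/
def IsContinuousRep {G V : Type*} [Group G] [TopologicalSpace G] [AddCommGroup V] [Module ℂ V]
    (ρ : Representation ℂ G V) : Prop :=
  ∀ (v : V) (l : Module.Dual ℂ V), Continuous fun g : G => l (ρ g v)

/-- `(G, H)` is a Gelfand pair: in every (continuous, finite-dimensional) irreducible complex
representation of `G`, the `H`-invariant vectors form a subspace of dimension at most one. -/
def IsGelfandPair (G : Type*) [Group G] [TopologicalSpace G] (H : Subgroup G) : Prop :=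
  ∀ (V : Type) [AddCommGroup V] [Module ℂ V] [FiniteDimensional ℂ V] (ρ : Representation ℂ G V),
    IsContinuousRep ρ → ρ.IsIrreducible →
      Module.finrank ℂ (Representation.invariants (ρ.comp H.subtype)) ≤ 1

/-- A probabilistic structure of the dynamical structure `(X, G)`: a set of outcome probability
functions (OPFs) on the pure states `X`. A measurement is any finite family of OPFs that sums to
the unit OPF. The last two fields are the conventions that mixed states live in a
finite-dimensional space and that the embedding of the pure states in it is continuous. -/
structure ProbabilisticStructure (G X : Type*) [Group G] [MulAction G X]
    [TopologicalSpace X] where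
  opf : Set (X → ℝ)
  nonempty : opf.Nonempty
  mem_Icc : ∀ f ∈ opf, ∀ x, f x ∈ Set.Icc (0 : ℝ) 1
  mixture : Convex ℝ opf
  comp_smul : ∀ f ∈ opf, ∀ g : G, (fun x => f (g • x)) ∈ opf
  coarse_graining : ∀ (n : ℕ) (f : Fin n → X → ℝ), (∀ i, f i ∈ opf) → ∑ i, f i = 1 →
    ∀ i j, i ≠ j → f i + f j ∈ opf
  complement : ∀ f ∈ opf, 1 - f ∈ opf
  finiteDimensional : FiniteDimensional ℝ (Submodule.span ℝ opf)
  continuous : ∀ f ∈ opf, Continuous f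

namespace ProbabilisticStructure

variable {G X : Type*} [Group G] [MulAction G X] [TopologicalSpace X]

/-- The real vector space `ℝ[F]` spanned by the OPFs. -/
abbrev opfSpace (F : ProbabilisticStructure G X) : Submodule ℝ (X → ℝ) :=
  Submodule.span ℝ F.opf

/-- The space `V = ℝ[F]*` in which the states live. -/
abbrev stateSpace (F : ProbabilisticStructure G X) : Type _ :=
  Module.Dual ℝ F.opfSpace

/-- The pure state `Ω x`, i.e. evaluation of OPFs at `x`. -/
def pureState (F : ProbabilisticStructure G X) (x : X) : F.stateSpace :=
  (LinearMap.proj x).comp F.opfSpace.subtype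

theorem comp_smul_mem_opfSpace (F : ProbabilisticStructure G X) (g : G) {f : X → ℝ}
    (hf : f ∈ F.opfSpace) : LinearMap.funLeft ℝ ℝ (fun x : X => g • x) f ∈ F.opfSpace := by
  have h : F.opfSpace ≤ F.opfSpace.comap (LinearMap.funLeft ℝ ℝ (fun x : X => g • x)) :=
    Submodule.span_le.2 fun f hf => Submodule.subset_span (F.comp_smul f hf g)
  exact h hf

/-- The action `(g f)(x) = f (g⁻¹ x)` of `G` on `ℝ[F]`. -/
def opfRep (F : ProbabilisticStructure G X) : Representation ℝ G F.opfSpace where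
  toFun g := (LinearMap.funLeft ℝ ℝ (fun x : X => g⁻¹ • x)).restrict
    fun _ hf => F.comp_smul_mem_opfSpace g⁻¹ hf
  map_one' := by
    ext f x
    simp [LinearMap.funLeft_apply]
  map_mul' g h := by
    ext f x
    simp [LinearMap.funLeft_apply, mul_smul]

/-- The representation `Γ` of `G` on `V = ℝ[F]*` associated to `F`,
`(Γ g ω)(f) = ω (f ∘ g)`. -/
def assocRep (F : ProbabilisticStructure G X) : Representation ℝ G F.stateSpace :=
  F.opfRep.dual

theorem assocRep_pureState (F : ProbabilisticStructure G X) (g : G) (x : X) :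
    F.assocRep g (F.pureState x) = F.pureState (g • x) := by
  ext f
  change (f : X → ℝ) (g⁻¹⁻¹ • x) = (f : X → ℝ) (g • x)
  rw [inv_inv]

/-- `F` is unrestricted: every linear functional on `V` that takes values in `[0,1]` on the pure
states gives an OPF of `F`. -/
def IsUnrestricted (F : ProbabilisticStructure G X) : Prop :=
  ∀ L : Module.Dual ℝ F.stateSpace, (∀ x, L (F.pureState x) ∈ Set.Icc (0 : ℝ) 1) →
    (fun x => L (F.pureState x)) ∈ F.opf

/-- The real representation `σ` appears in `F`: it is equivalent to a subrepresentation of the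
associated representation of `F`. -/
def Contains (F : ProbabilisticStructure G X) {W : Type*} [AddCommGroup W] [Module ℝ W]
    (σ : Representation ℝ G W) : Prop :=
  ∃ T : Representation.IntertwiningMap σ F.assocRep, Function.Injective T

end ProbabilisticStructure

/-- The distance `sup_x |f₀ x - f₁ x|` between two OPFs. -/
noncomputable def opfDist {X : Type*} (f₀ f₁ : X → ℝ) : ℝ :=
  ⨆ x, |f₀ x - f₁ x|

/-- The operational distance `D(F₀, F₁) = sup_{f₀ ∈ F₀} inf_{f₁ ∈ F₁} dist(f₀, f₁)`. The OPF sets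
are nonempty and all quantities lie in `[0,1]` (see the two bounds below), so that the suprema and
infima are the genuine ones. -/
noncomputable def operationalDist {G X : Type*} [Group G] [MulAction G X] [TopologicalSpace X]
    (F₀ F₁ : ProbabilisticStructure G X) : ℝ :=
  ⨆ f₀ : F₀.opf, ⨅ f₁ : F₁.opf, opfDist (f₀ : X → ℝ) (f₁ : X → ℝ)

theorem abs_opf_sub_le_one {G X : Type*} [Group G] [MulAction G X] [TopologicalSpace X]
    (F₀ F₁ : ProbabilisticStructure G X) (f₀ : F₀.opf) (f₁ : F₁.opf) (x : X) :
    |(f₀ : X → ℝ) x - (f₁ : X → ℝ) x| ≤ 1 := by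
  have h₀ := F₀.mem_Icc _ f₀.2 x
  have h₁ := F₁.mem_Icc _ f₁.2 x
  rw [abs_le]
  constructor <;> linarith [h₀.1, h₀.2, h₁.1, h₁.2]

theorem iInf_opfDist_mem_Icc {G X : Type*} [Group G] [MulAction G X] [TopologicalSpace X]
    (F₀ F₁ : ProbabilisticStructure G X) (f₀ : F₀.opf) :
    (⨅ f₁ : F₁.opf, opfDist (f₀ : X → ℝ) (f₁ : X → ℝ)) ∈ Set.Icc (0 : ℝ) 1 := by
  have h0 : ∀ f₁ : F₁.opf, 0 ≤ opfDist (f₀ : X → ℝ) (f₁ : X → ℝ) := fun f₁ =>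
    Real.iSup_nonneg fun x => abs_nonneg _
  obtain ⟨f, hf⟩ := F₁.nonempty
  refine ⟨Real.iInf_nonneg h0, ?_⟩
  refine (ciInf_le ⟨0, ?_⟩ (⟨f, hf⟩ : F₁.opf)).trans ?_
  · rintro _ ⟨f₁, rfl⟩
    exact h0 f₁
  · exact Real.iSup_le (fun x => abs_opf_sub_le_one F₀ F₁ f₀ ⟨f, hf⟩ x) zero_le_one

/-! The `L²` pairing of an invariant probability measure makes `ℝ[F₀]` self-dual, so a
representation `σ` of dimension `d` that appears in `F₀` is realized by functions in `ℝ[F₀]`. The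
reproducing kernel `κ` of this realization at a point satisfies `‖κ‖² = d` and, by transitivity,
`|κ| ≤ d`. Hence `φ = κ / d` takes values in `[-1, 1]`, and `f₀ = (1 + φ) / 2` is an OPF of the
unrestricted structure `F₀`. If `σ` is irreducible and does not appear in `F₁`, then `φ` is
orthogonal to `ℝ[F₁]` by Schur's lemma, so that every OPF `f₁` of `F₁` satisfies
`1 / (2 d) = ‖φ‖² / 2 = ⟨φ, f₀ - f₁⟩ ≤ sup |f₀ - f₁|`. -/

open MeasureTheory

section InvariantPairing

variable {k G W V : Type*} [CommRing k] [Group G] [AddCommGroup W] [Module k W] [AddCommGroup V]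
  [Module k V]

/-- A bilinear pairing between two representations is invariant when it is unchanged by the
simultaneous action of the group on both arguments. Such pairings are the intertwining maps into
the dual representation. -/
def IsInvariantPairing (σ : Representation k G W) (ρ : Representation k G V)
    (B : W →ₗ[k] V →ₗ[k] k) : Prop :=
  ∀ g w v, B (σ g w) (ρ g v) = B w v

namespace IsInvariantPairing

variable {σ : Representation k G W} {ρ : Representation k G V} {B : W →ₗ[k] V →ₗ[k] k}

theorem compl₁₂ (hB : IsInvariantPairing σ ρ B) {W' V' : Type*} [AddCommGroup W'] [Module k W']
    [AddCommGroup V'] [Module k V'] {σ' : Representation k G W'} {ρ' : Representation k G V'}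
    (S : σ'.IntertwiningMap σ) (T : ρ'.IntertwiningMap ρ) :
    IsInvariantPairing σ' ρ' (B.compl₁₂ S.toLinearMap T.toLinearMap) := fun g w v => by
  simpa only [LinearMap.compl₁₂_apply, Representation.IntertwiningMap.toLinearMap_apply,
    S.isIntertwining, T.isIntertwining] using hB g (S w) (T v)

/-- The intertwining map into the dual representation given by an invariant pairing. -/
def toDual (hB : IsInvariantPairing σ ρ B) : σ.IntertwiningMap ρ.dual :=
  B.intertwiningMap_of_isIntertwiningMap σ ρ.dual fun g w => by
    ext v
    simpa only [Representation.dual_apply, Module.Dual.transpose_apply,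
      LinearMap.comp_apply, Representation.self_inv_apply] using hB g w (ρ g⁻¹ v)

end IsInvariantPairing

end InvariantPairing

namespace IsInvariantPairing

variable {k G W V : Type*} [Field k] [Group G] [AddCommGroup W] [Module k W] [AddCommGroup V]
  [Module k V] {σ : Representation k G W} {ρ : Representation k G V}

theorem eq_zero_of_isIrreducible {B : W →ₗ[k] V →ₗ[k] k} (hB : IsInvariantPairing σ ρ B)
    (hσ : σ.IsIrreducible)
    (h : ¬ ∃ T : σ.IntertwiningMap ρ.dual, Function.Injective T) : B = 0 := by
  have : hB.toDual = 0 :=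
    (Representation.IsIrreducible.injective_or_eq_zero hB.toDual).resolve_left fun hinj =>
      h ⟨_, hinj⟩
  exact congrArg Representation.IntertwiningMap.toLinearMap this

/-- The self-duality of a finite-dimensional representation with a nondegenerate invariant form. -/
noncomputable def equivDual {B : LinearMap.BilinForm k V} [FiniteDimensional k V]
    (hB : IsInvariantPairing ρ ρ B) (hnd : B.Nondegenerate) : ρ.Equiv ρ.dual :=
  .mk (B.toDual hnd) hB.toDual.isIntertwining'

end IsInvariantPairing

/-- The representation `(g f)(x) = f (g⁻¹ x)` of `G` on the continuous functions on `X`. -/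
def translationRep (G X : Type*) [Group G] [TopologicalSpace X] [MulAction G X]
    [ContinuousConstSMul G X] : Representation ℝ G C(X, ℝ) where
  toFun g := (ContinuousMap.compRightAlgHom ℝ ℝ ⟨(g⁻¹ • ·), continuous_const_smul g⁻¹⟩).toLinearMap
  map_one' := by
    ext f x
    simp
  map_mul' g h := by
    ext f x
    simp [mul_smul]

theorem translationRep_apply {G X : Type*} [Group G] [TopologicalSpace X] [MulAction G X]
    [ContinuousConstSMul G X] (g : G) (f : C(X, ℝ)) (x : X) :
    translationRep G X g f x = f (g⁻¹ • x) := rfl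

section L2Pairing

variable {X : Type*} [TopologicalSpace X] [CompactSpace X] [MeasurableSpace X] [BorelSpace X]
  (ν : Measure X) [IsFiniteMeasure ν]

/-- The `L²` pairing of continuous functions on a compact space. -/
noncomputable def l2Pairing : LinearMap.BilinForm ℝ C(X, ℝ) :=
  (innerₗ (Lp ℝ 2 ν)).compl₁₂ (ContinuousMap.toLp 2 ν ℝ).toLinearMap
    (ContinuousMap.toLp 2 ν ℝ).toLinearMap

theorem l2Pairing_eq_inner (f h : C(X, ℝ)) :
    l2Pairing ν f h = inner ℝ (ContinuousMap.toLp 2 ν ℝ f) (ContinuousMap.toLp 2 ν ℝ h) := rfl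

theorem l2Pairing_apply (f h : C(X, ℝ)) : l2Pairing ν f h = ∫ x, f x * h x ∂ν := by
  simp only [l2Pairing_eq_inner, ContinuousMap.inner_toLp, conj_trivial, mul_comm]

theorem l2Pairing_comm (f h : C(X, ℝ)) : l2Pairing ν f h = l2Pairing ν h f := by
  rw [l2Pairing_eq_inner, l2Pairing_eq_inner, real_inner_comm]

theorem l2Pairing_self_eq_zero [ν.IsOpenPosMeasure] {f : C(X, ℝ)} :
    l2Pairing ν f f = 0 ↔ f = 0 := by
  rw [l2Pairing_eq_inner, inner_self_eq_zero,
    map_eq_zero_iff (ContinuousMap.toLp 2 ν ℝ) (ContinuousMap.toLp_injective ν)]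

theorem nondegenerate_l2Pairing_compl₁₂ [ν.IsOpenPosMeasure] {V : Type*} [AddCommGroup V]
    [Module ℝ V] {A : V →ₗ[ℝ] C(X, ℝ)} (hA : Function.Injective A) :
    LinearMap.BilinForm.Nondegenerate ((l2Pairing ν).compl₁₂ A A) := by
  have hsymm : ((l2Pairing ν).compl₁₂ A A).IsRefl := fun v w h =>
    (l2Pairing_comm ν (A w) (A v)).trans h
  exact hsymm.nondegenerate_iff_separatingLeft.2 fun v hv =>
    (map_eq_zero_iff A hA).1 <| (l2Pairing_self_eq_zero ν).1 (hv v)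

theorem isInvariantPairing_l2Pairing {G : Type*} [Group G] [MulAction G X]
    [ContinuousConstSMul G X] [SMulInvariantMeasure G X ν] :
    IsInvariantPairing (translationRep G X) (translationRep G X) (l2Pairing ν) := fun g f h => by
  simp only [l2Pairing_apply, translationRep_apply]
  exact integral_smul_eq_self (fun x => f x * h x) (g := g⁻¹)

end L2Pairing

theorem l2Pairing_le {X : Type*} [TopologicalSpace X] [CompactSpace X] [MeasurableSpace X]
    [BorelSpace X] (ν : Measure X) [IsProbabilityMeasure ν] {f h : C(X, ℝ)} {s : ℝ}
    (hf : ∀ x, |f x| ≤ 1) (hh : ∀ x, |h x| ≤ s) : l2Pairing ν f h ≤ s := by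
  have hfh : ∀ x, ‖f x * h x‖ ≤ s := fun x => by
    rw [norm_mul]
    exact (mul_le_of_le_one_left (norm_nonneg _) (hf x)).trans (hh x)
  rw [l2Pairing_apply]
  simpa only [probReal_univ, mul_one] using
    (le_abs_self _).trans (norm_integral_le_of_norm_le_const (μ := ν) (.of_forall hfh))

section ReproducingKernel

variable {X W : Type*} [TopologicalSpace X] [NormedAddCommGroup W] [InnerProductSpace ℝ W]
  [FiniteDimensional ℝ W]

/-- The reproducing kernel at `x` of a finite-dimensional inner product space `W` realized by
continuous functions: the vector of `W` that represents evaluation at `x`. -/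
noncomputable def kernelAt (A : W →ₗ[ℝ] C(X, ℝ)) (x : X) : W :=
  (InnerProductSpace.toDual ℝ W).symm
    (LinearMap.toContinuousLinearMap ((ContinuousMap.evalCLM ℝ x).toLinearMap ∘ₗ A))

theorem inner_kernelAt (A : W →ₗ[ℝ] C(X, ℝ)) (x : X) (w : W) :
    inner ℝ (kernelAt A x) w = A w x :=
  InnerProductSpace.toDual_symm_apply

variable {G : Type*} [Group G] [MulAction G X] [ContinuousConstSMul G X]
  {σ : Representation ℝ G W} (A : σ.IntertwiningMap (translationRep G X))

theorem rep_kernelAt (hσ : ∀ g v w, inner ℝ (σ g v) (σ g w) = inner ℝ v w) (g : G) (x : X) :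
    σ g (kernelAt A.toLinearMap x) = kernelAt A.toLinearMap (g • x) := by
  refine ext_inner_right ℝ fun w => ?_
  rw [inner_kernelAt, ← hσ g⁻¹, Representation.inv_self_apply, inner_kernelAt,
    A.toLinearMap_apply, A.isIntertwining, translationRep_apply, inv_inv, A.toLinearMap_apply]

theorem norm_kernelAt_eq [MulAction.IsPretransitive G X]
    (hσ : ∀ g v w, inner ℝ (σ g v) (σ g w) = inner ℝ v w) (x y : X) :
    ‖kernelAt A.toLinearMap x‖ = ‖kernelAt A.toLinearMap y‖ := by
  obtain ⟨g, rfl⟩ := MulAction.exists_smul_eq G x y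
  rw [← rep_kernelAt A hσ, norm_eq_sqrt_real_inner, norm_eq_sqrt_real_inner, hσ]

variable [CompactSpace X] [MulAction.IsPretransitive G X] [MeasurableSpace X] [BorelSpace X]
  (ν : Measure X) [IsProbabilityMeasure ν] [SMulInvariantMeasure G X ν]

theorem norm_kernelAt_sq (hA : ∀ v w, inner ℝ v w = l2Pairing ν (A v) (A w)) (x : X) :
    ‖kernelAt A.toLinearMap x‖ ^ 2 = Module.finrank ℝ W := by
  have hσ : ∀ g v w, inner ℝ (σ g v) (σ g w) = inner ℝ v w := fun g v w => by
    rw [hA, hA]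
    exact (isInvariantPairing_l2Pairing ν).compl₁₂ A A g v w
  let b := stdOrthonormalBasis ℝ W
  have parseval (y : X) : ‖kernelAt A.toLinearMap y‖ ^ 2 = ∑ i, A (b i) y ^ 2 := by
    simp only [← b.sum_sq_inner_left, inner_kernelAt, A.toLinearMap_apply]
  have integral_sq (i) : ∫ y, A (b i) y ^ 2 ∂ν = 1 := by
    simp only [sq, ← l2Pairing_apply, ← hA, real_inner_self_eq_norm_mul_norm, b.norm_eq_one,
      mul_one]
  calc ‖kernelAt A.toLinearMap x‖ ^ 2
      = ∫ y, ‖kernelAt A.toLinearMap y‖ ^ 2 ∂ν := by simp [norm_kernelAt_eq A hσ _ x]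
    _ = ∑ i, ∫ y, A (b i) y ^ 2 ∂ν := by
      simp only [parseval]
      exact integral_finsetSum _ fun i _ =>
        ((A (b i)).continuous.pow 2).integrable_of_hasCompactSupport (.of_compactSpace _)
    _ = Module.finrank ℝ W := by simp [integral_sq]

theorem abs_apply_kernelAt_le (hA : ∀ v w, inner ℝ v w = l2Pairing ν (A v) (A w)) (x y : X) :
    |A (kernelAt A.toLinearMap x) y| ≤ Module.finrank ℝ W := by
  rw [← A.toLinearMap_apply, ← inner_kernelAt]
  refine abs_le_of_sq_le_sq ?_ (Nat.cast_nonneg _)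
  calc inner ℝ (kernelAt A.toLinearMap y) (kernelAt A.toLinearMap x) ^ 2
      ≤ (‖kernelAt A.toLinearMap y‖ * ‖kernelAt A.toLinearMap x‖) ^ 2 :=
        sq_le_sq' (neg_le_of_abs_le (abs_real_inner_le_norm _ _)) (real_inner_le_norm _ _)
    _ = (Module.finrank ℝ W : ℝ) ^ 2 := by
      rw [mul_pow, norm_kernelAt_sq A ν hA, norm_kernelAt_sq A ν hA, sq]

end ReproducingKernel

theorem isOpenPosMeasure_of_smulInvariant (G : Type*) {X : Type*} [Group G] [TopologicalSpace X]
    [CompactSpace X] [MeasurableSpace X] [MulAction G X] [ContinuousConstSMul G X]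
    [MulAction.IsMinimal G X] (ν : Measure X) [NeZero ν] [SMulInvariantMeasure G X ν] :
    ν.IsOpenPosMeasure where
  open_pos _ hU hne := (measure_isOpen_pos_of_smulInvariant_of_compact_ne_zero G isCompact_univ
    (Measure.measure_univ_ne_zero.2 (NeZero.ne ν)) hU hne).ne'

theorem exists_invariant_probabilityMeasure (G X : Type*) [Group G] [TopologicalSpace G]
    [IsTopologicalGroup G] [CompactSpace G] [TopologicalSpace X] [Nonempty X] [MulAction G X]
    [ContinuousSMul G X] [MeasurableSpace X] [BorelSpace X] :
    ∃ ν : Measure X, IsProbabilityMeasure ν ∧ SMulInvariantMeasure G X ν := by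
  let _ : MeasurableSpace G := borel G
  have : BorelSpace G := ⟨rfl⟩
  have : IsProbabilityMeasure (Measure.haarMeasure (⊤ : TopologicalSpace.PositiveCompacts G)) :=
    ⟨Measure.haarMeasure_self⟩
  let x₀ : X := Classical.arbitrary X
  have measurable_orbit : Measurable fun g : G => g • x₀ := by fun_prop
  exact ⟨(Measure.haarMeasure ⊤).map (· • x₀),
    Measure.isProbabilityMeasure_map measurable_orbit.aemeasurable,
    smulInvariantMeasure_map _ _ (fun g h => mul_smul g h x₀) measurable_orbit⟩

theorem exists_l2Pairing_self_eq_inv_finrank_and_abs_le_one {G X W : Type*} [Group G]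
    [TopologicalSpace X] [CompactSpace X] [MulAction G X] [ContinuousConstSMul G X]
    [MulAction.IsPretransitive G X] [MeasurableSpace X] [BorelSpace X] (ν : Measure X)
    [IsProbabilityMeasure ν] [SMulInvariantMeasure G X ν] [AddCommGroup W] [Module ℝ W]
    [FiniteDimensional ℝ W] {σ : Representation ℝ G W}
    (A : σ.IntertwiningMap (translationRep G X)) (hA : Function.Injective A) :
    ∃ w : W, l2Pairing ν (A w) (A w) = (Module.finrank ℝ W : ℝ)⁻¹ ∧ ∀ x, |A w x| ≤ 1 := by
  have := isOpenPosMeasure_of_smulInvariant G ν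
  obtain ⟨x₀⟩ := nonempty_of_isProbabilityMeasure ν
  let T : W →ₗ[ℝ] Lp ℝ 2 ν := (ContinuousMap.toLp 2 ν ℝ).toLinearMap ∘ₗ A.toLinearMap
  let _ : NormedAddCommGroup W :=
    NormedAddCommGroup.induced W (Lp ℝ 2 ν) T ((ContinuousMap.toLp_injective ν).comp hA)
  let _ : InnerProductSpace ℝ W := InnerProductSpace.induced T
  have isometry (v w : W) : inner ℝ v w = l2Pairing ν (A v) (A w) := rfl
  let κ : W := kernelAt A.toLinearMap x₀
  have hκ : l2Pairing ν (A κ) (A κ) = Module.finrank ℝ W := by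
    rw [← isometry, real_inner_self_eq_norm_sq, norm_kernelAt_sq A ν isometry]
  refine ⟨(Module.finrank ℝ W : ℝ)⁻¹ • κ, ?_, fun x => ?_⟩
  · simpa [hκ, mul_assoc] using mul_self_mul_inv (Module.finrank ℝ W : ℝ)⁻¹
  · simpa [κ, abs_mul, inv_mul_eq_div, abs_div] using
      div_le_one_of_le₀ (abs_apply_kernelAt_le A ν isometry x₀ x) (Nat.cast_nonneg _)

namespace ProbabilisticStructure

variable {G X : Type*} [Group G] [MulAction G X] [TopologicalSpace X]

theorem one_mem_opfSpace (F : ProbabilisticStructure G X) : (1 : X → ℝ) ∈ F.opfSpace := by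
  obtain ⟨f, hf⟩ := F.nonempty
  simpa using add_mem (Submodule.subset_span hf) (Submodule.subset_span (F.complement f hf))

theorem continuous_of_mem_opfSpace (F : ProbabilisticStructure G X) {f : X → ℝ}
    (hf : f ∈ F.opfSpace) : Continuous f := by
  induction hf using Submodule.span_induction with
  | mem f hf => exact F.continuous f hf
  | zero => exact continuous_const
  | add f h _ _ hf hh => exact hf.add hh
  | smul c f _ hf => exact continuous_const.mul hf

theorem IsUnrestricted.mem_opf {F : ProbabilisticStructure G X} (hF : F.IsUnrestricted)
    {f : X → ℝ} (hf : f ∈ F.opfSpace) (h : ∀ x, f x ∈ Set.Icc (0 : ℝ) 1) : f ∈ F.opf :=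
  hF (Module.Dual.eval ℝ F.opfSpace ⟨f, hf⟩) h

theorem IsUnrestricted.half_one_add_mem_opf {F : ProbabilisticStructure G X}
    (hF : F.IsUnrestricted) {f : X → ℝ} (hf : f ∈ F.opfSpace) (h : ∀ x, |f x| ≤ 1) :
    (2⁻¹ : ℝ) • (1 + f) ∈ F.opf := by
  refine hF.mem_opf (F.opfSpace.smul_mem _ (add_mem F.one_mem_opfSpace hf)) fun x => ?_
  simp only [Pi.smul_apply, Pi.add_apply, Pi.one_apply, smul_eq_mul]
  constructor <;> linarith [abs_le.1 (h x)]

theorem abs_sub_le_opfDist (F₀ F₁ : ProbabilisticStructure G X) {f₀ f₁ : X → ℝ}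
    (h₀ : f₀ ∈ F₀.opf) (h₁ : f₁ ∈ F₁.opf) (x : X) : |f₀ x - f₁ x| ≤ opfDist f₀ f₁ :=
  le_ciSup (f := fun x => |f₀ x - f₁ x|)
    ⟨1, Set.forall_mem_range.2 (abs_opf_sub_le_one F₀ F₁ ⟨f₀, h₀⟩ ⟨f₁, h₁⟩)⟩ x

theorem le_operationalDist {F₀ F₁ : ProbabilisticStructure G X} {f₀ : X → ℝ}
    (h₀ : f₀ ∈ F₀.opf) {c : ℝ} (hc : ∀ f₁ ∈ F₁.opf, c ≤ opfDist f₀ f₁) :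
    c ≤ operationalDist F₀ F₁ := by
  have : Nonempty F₁.opf := F₁.nonempty.to_subtype
  exact (le_ciInf fun f₁ : F₁.opf => hc f₁ f₁.2).trans
    (le_ciSup (f := fun f₀ : F₀.opf => ⨅ f₁ : F₁.opf, opfDist (f₀ : X → ℝ) (f₁ : X → ℝ))
      ⟨1, Set.forall_mem_range.2 fun f => (iInf_opfDist_mem_Icc F₀ F₁ f).2⟩ ⟨f₀, h₀⟩)

variable [ContinuousConstSMul G X]

/-- The inclusion of `ℝ[F]` in the continuous functions on `X`. -/
def opfInclusion (F : ProbabilisticStructure G X) :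
    F.opfRep.IntertwiningMap (translationRep G X) where
  toFun f := ⟨f, F.continuous_of_mem_opfSpace f.2⟩
  map_add' _ _ := rfl
  map_smul' _ _ := rfl
  isIntertwining' _ := rfl

theorem opfInclusion_injective (F : ProbabilisticStructure G X) :
    Function.Injective F.opfInclusion := fun _ _ h =>
  Subtype.ext (congrArg DFunLike.coe h)

variable [CompactSpace X] [MeasurableSpace X] [BorelSpace X] (ν : Measure X)
  [IsFiniteMeasure ν] [SMulInvariantMeasure G X ν]

theorem Contains.exists_injective_opfRep [ν.IsOpenPosMeasure] {F : ProbabilisticStructure G X}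
    {W : Type*} [AddCommGroup W] [Module ℝ W] {σ : Representation ℝ G W} (h : F.Contains σ) :
    ∃ A : σ.IntertwiningMap F.opfRep, Function.Injective A := by
  have := F.finiteDimensional
  obtain ⟨T, hT⟩ := h
  let e : F.opfRep.Equiv F.assocRep :=
    ((isInvariantPairing_l2Pairing ν).compl₁₂ F.opfInclusion F.opfInclusion).equivDual
      (nondegenerate_l2Pairing_compl₁₂ ν F.opfInclusion_injective)
  exact ⟨e.symm.toIntertwiningMap.comp T, e.symm.toLinearEquiv.injective.comp hT⟩

theorem l2Pairing_opfInclusion_eq_zero {F : ProbabilisticStructure G X} {W : Type*}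
    [AddCommGroup W] [Module ℝ W] {σ : Representation ℝ G W} (hσ : σ.IsIrreducible)
    (h : ¬ F.Contains σ) (A : σ.IntertwiningMap (translationRep G X)) (w : W) (f : F.opfSpace) :
    l2Pairing ν (A w) (F.opfInclusion f) = 0 :=
  LinearMap.congr_fun₂ (((isInvariantPairing_l2Pairing ν).compl₁₂ A F.opfInclusion)
    |>.eq_zero_of_isIrreducible hσ h) w f

end ProbabilisticStructure

theorem theorem3_general {G X : Type*} [Group G] [TopologicalSpace X] [CompactSpace X]
    [MulAction G X] [ContinuousConstSMul G X] [MulAction.IsPretransitive G X]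
    [MeasurableSpace X] [BorelSpace X] (ν : Measure X) [IsProbabilityMeasure ν]
    [SMulInvariantMeasure G X ν] (F₀ F₁ : ProbabilisticStructure G X) (hF₀ : F₀.IsUnrestricted)
    {W : Type*} [AddCommGroup W] [Module ℝ W] (σ : Representation ℝ G W)
    (hσ : σ.IsIrreducible) (h₀ : F₀.Contains σ) (h₁ : ¬ F₁.Contains σ) :
    operationalDist F₀ F₁ ≥ 1 / (2 * (Module.finrank ℝ W : ℝ)) := by
  have := isOpenPosMeasure_of_smulInvariant G ν
  obtain ⟨A, hA⟩ := h₀.exists_injective_opfRep ν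
  have := F₀.finiteDimensional
  have : FiniteDimensional ℝ W := .of_injective A.toLinearMap hA
  obtain ⟨w, norm_sq, abs_le_one⟩ := exists_l2Pairing_self_eq_inv_finrank_and_abs_le_one ν
    (F₀.opfInclusion.comp A) (F₀.opfInclusion_injective.comp hA)
  set φ : C(X, ℝ) := F₀.opfInclusion.comp A w
  have orthogonal (f : F₁.opfSpace) : l2Pairing ν φ (F₁.opfInclusion f) = 0 :=
    F₁.l2Pairing_opfInclusion_eq_zero ν hσ h₁ (F₀.opfInclusion.comp A) w f
  have orthogonal_one : l2Pairing ν φ 1 = 0 := orthogonal ⟨1, F₁.one_mem_opfSpace⟩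
  have hf₀ : (2⁻¹ : ℝ) • (1 + ⇑φ) ∈ F₀.opf := hF₀.half_one_add_mem_opf (A w).2 abs_le_one
  refine ProbabilisticStructure.le_operationalDist hf₀ fun f₁ hf₁ => ?_
  let ψ : C(X, ℝ) := F₁.opfInclusion ⟨f₁, Submodule.subset_span hf₁⟩
  calc 1 / (2 * (Module.finrank ℝ W : ℝ)) = l2Pairing ν φ ((2⁻¹ : ℝ) • (1 + φ) - ψ) := by
        simp [ψ, orthogonal, orthogonal_one, norm_sq, mul_comm]
    _ ≤ opfDist ((2⁻¹ : ℝ) • (1 + ⇑φ)) f₁ :=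
        l2Pairing_le ν abs_le_one (F₀.abs_sub_le_opfDist F₁ hf₀ hf₁)

theorem theorem3 {G : Type*} [Group G] [TopologicalSpace G] [IsTopologicalGroup G]
    [CompactSpace G] [T2Space G] (H : Subgroup G) (hH : IsClosed (H : Set G))
    (hGelfand : IsGelfandPair G H)
    (F₀ F₁ : ProbabilisticStructure G (G ⧸ H))
    (hF₀ : F₀.IsUnrestricted) (hF₁ : F₁.IsUnrestricted)
    {W : Type*} [AddCommGroup W] [Module ℝ W] (σ : Representation ℝ G W)
    (hσ : σ.IsIrreducible) (h₀ : F₀.Contains σ) (h₁ : ¬ F₁.Contains σ) :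
    operationalDist F₀ F₁ ≥ 1 / (4 * (Module.finrank ℝ W : ℝ)) := by
  borelize (G ⧸ H)
  obtain ⟨ν, _, _⟩ := exists_invariant_probabilityMeasure G (G ⧸ H)
  refine le_trans ?_ (theorem3_general ν F₀ F₁ hF₀ σ hσ h₀ h₁)
  simp only [one_div, mul_inv]
  gcongr
  norm_num
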